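/- **Notation.** Let $\|\cdot\|$ be the Euclidean norm on $\mathbb R^n$. Let $\psi:\mathbb R^n\to(-\infty,\infty]$ be proper, lower semicontinuous and convex, with $\operatorname{dom}\psi=\{z:\psi(z)<\infty\}$ and $$\operatorname{prox}_\psi(z_0)=\operatorname*{argmin}_{z\in\mathbb R^n}\{\psi(z)+\tfrac12\|z-z_0\|^2\}.$$ For $\alpha\in(1,\infty)$ and probability measures $\mu,\nu$ on $\mathbb R^n$, let $D_\alpha(\mu\|\nu)=\frac1{\alpha-1}\log\int\left(\frac{d\mu}{d\nu}\right)^{\alpha}d\nu$ if $\mu\ll\nu$, and $D_\alpha(\mu\|\nu)=\infty$ otherwise. For $\tau\ge0$ let $$D_\alpha^{(\tau)}(\mu\|\nu)=\inf\{D_\alpha(\gamma\|\nu):\gamma\text{ a probability measure},\ \mathcal W_\infty(\mu,\gamma)\le\tau\},$$ where $\mathcal W_\infty(\mu,\gamma)$ is the infimum, over all couplings $\pi$ of $\mu$ and $\gamma$, of $\operatorname{ess\,sup}_{(x,y)\sim\pi}\|x-y\|$. For random vectors, $D_\alpha(X\|X')$ and $D^{(\tau)}_\alpha(X\|X')$ refer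 to their laws. For $L\ge0$ let $\theta_L(0)=0$ and $\theta_L(s)=L^{2(s-1)}\big/\sum_{j=0}^{s-1}L^{2j}$ for integers $s\ge1$ (with $0^0=1$). **Proposition.** Let $\alpha>1$, $\sigma>0$, $L,\zeta\ge0$, $\bar s>0$, and let $1\le\ell\le T$ be integers. For $t=1,\dots,T$ let $\phi_t,\phi_t'$ be Borel measurable maps into $\mathbb R^n$ whose domains contain $\operatorname{dom}\psi$ and which satisfy, for all $x,y,u\in\operatorname{dom}\psi$, $$\|\Phi(x)-\Phi(y)\|\le L\|x-y\|+\zeta\quad\text{for }\Phi\in\{\phi_t,\phi_t'\},\qquad \|\phi_t'(u)-\phi_t(u)\|\le\begin{cases}\bar s,& t\equiv1\pmod\ell,\\0,&\text{otherwise.}\end{cases}$$ Let $Z_1,Z_2,\dots$ be independent $\mathcal N(0,\sigma^2I)$ random vectors, and let $Y_0,Y_0'$ be random vectors with values in $\operatorname{dom}\psi$ almost surely, each of which is independent of $(Z_t)_{t\ge1}$ (no assumption is made on the joint law of $Y_0$ and $Y_0'$). For $1\le t\le T$ let $$Y_t=\operatorname{prox}_\psi(\phi_t(Y_{t-1})+Z_t),\qquad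 Y_t'=\operatorname{prox}_\psi(\phi_t'(Y_{t-1}')+Z_t),$$ and put $E=\lfloor T/\ell\rfloor$. (a) If $\zeta=0$, then for every $\tau\ge0$ $$D_\alpha(Y_T\|Y_T')\le D_\alpha^{(\tau)}(Y_0\|Y_0')+\frac{\alpha}{2\sigma^2}\Big[(L\tau+\bar s)^2\theta_L(\ell)+\bar s^2\big\{(E-1)\theta_L(\ell)+\theta_L(T-E\ell)\big\}\Big].$$ (b) If $\zeta=\bar s$, then $$D_\alpha(Y_T\|Y_T')\le D_\alpha(Y_0\|Y_0')+2\alpha T\left(\frac{\zeta}{\sigma}\right)^2.$$ -/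

import Mathlib

open MeasureTheory ProbabilityTheory
open scoped ENNReal

namespace ProxDiv

/-- The effective domain `{z | ψ z < ∞}` of an extended-real-valued function. -/
def effDom {n : ℕ} (ψ : EuclideanSpace ℝ (Fin n) → EReal) : Set (EuclideanSpace ℝ (Fin n)) :=
  {z | ψ z < ⊤}

/-- `ψ : ℝⁿ → (-∞, ∞]` is proper, lower semicontinuous and convex
(convexity is expressed by convexity of the epigraph). -/
structure IsClosedConvexProper {n : ℕ} (ψ : EuclideanSpace ℝ (Fin n) → EReal) : Prop where
  ne_bot : ∀ z, ψ z ≠ ⊥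
  proper : (effDom ψ).Nonempty
  lsc : LowerSemicontinuous ψ
  convex : Convex ℝ {p : EuclideanSpace ℝ (Fin n) × ℝ | ψ p.1 ≤ (p.2 : EReal)}

/-- The objective `ψ z + ‖z - z₀‖² / 2` of the proximal subproblem at `z₀`. -/
noncomputable def proxObjective {n : ℕ} (ψ : EuclideanSpace ℝ (Fin n) → EReal)
    (z₀ z : EuclideanSpace ℝ (Fin n)) : EReal :=
  ψ z + ((‖z - z₀‖ ^ 2 / 2 : ℝ) : EReal)

/-- The proximal operator: a minimizer of the proximal subproblem
(it exists and is unique for proper, lower semicontinuous, convex `ψ`). -/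
noncomputable def prox {n : ℕ} (ψ : EuclideanSpace ℝ (Fin n) → EReal)
    (z₀ : EuclideanSpace ℝ (Fin n)) : EuclideanSpace ℝ (Fin n) :=
  Classical.epsilon fun z => ∀ w, proxObjective ψ z₀ z ≤ proxObjective ψ z₀ w

/-- The set of couplings of `μ` and `ν`. -/
def couplings {n : ℕ} (μ ν : Measure (EuclideanSpace ℝ (Fin n))) :
    Set (Measure (EuclideanSpace ℝ (Fin n) × EuclideanSpace ℝ (Fin n))) :=
  {γ | γ.map Prod.fst = μ ∧ γ.map Prod.snd = ν}

/-- The `∞`-Wasserstein distance, with values in `[0, ∞]`. -/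
noncomputable def wassersteinInf {n : ℕ} (μ ν : Measure (EuclideanSpace ℝ (Fin n))) : ℝ≥0∞ :=
  ⨅ γ ∈ couplings μ ν, essSup (fun p => ‖p.1 - p.2‖ₑ) γ

open Classical in
/-- The Rényi divergence of order `α ∈ (1, ∞)` of probability measures:
`(α - 1)⁻¹ log ∫ (dμ/dν)^α dν` if `μ ≪ ν`, and `∞` otherwise. -/
noncomputable def renyiDiv {n : ℕ} (α : ℝ) (μ ν : Measure (EuclideanSpace ℝ (Fin n))) : EReal :=
  if μ ≪ ν then (((α - 1)⁻¹ : ℝ) : EReal) * ENNReal.log (∫⁻ x, (μ.rnDeriv ν x) ^ α ∂ν) else ⊤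

/-- The shifted Rényi divergence: the infimum of `D_α(γ‖ν)` over the probability measures `γ`
within `∞`-Wasserstein distance `τ` of `μ`. -/
noncomputable def shiftedRenyiDiv {n : ℕ} (α τ : ℝ)
    (μ ν : Measure (EuclideanSpace ℝ (Fin n))) : EReal :=
  ⨅ (γ : Measure (EuclideanSpace ℝ (Fin n))) (_ : IsProbabilityMeasure γ)
    (_ : wassersteinInf μ γ ≤ ENNReal.ofReal τ), renyiDiv α γ ν

/-- `θ_L(0) = 0` and `θ_L(s) = L^{2(s-1)} / ∑_{j=0}^{s-1} L^{2j}` for `s ≥ 1`. -/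
noncomputable def theta (L : ℝ) (s : ℕ) : ℝ :=
  if s = 0 then 0 else L ^ (2 * (s - 1)) / ∑ j ∈ Finset.range s, L ^ (2 * j)

end ProxDiv

/-! This is a shifted-divergence argument. Along the two processes one tracks a pair `(c, τ)`: the
law of `Y t` can be coupled within distance `τ` to some `γ` whose density relative to the law of `Y'
t` has `L^α` norm at most `exp c`. One step enlarges the displacement to at most `b`, by the
Lipschitz bound and the perturbation. A part `a ≤ b` of it is then absorbed by moving the mean of
the Gaussian noise, which adds `(α - 1) a² / (2σ²)` to `c`. The remaining `b - a` stays as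
displacement, and the nonexpansive `prox` does not increase it (`ShiftedDualBound.step`). Since a
bound `c` amounts to a Rényi divergence `α / (α - 1) * c`, absorbing `a` costs `α a² / (2σ²)`.

The `L^α` bound is kept in its dual form, tested against `L^β` functions (`DualBound`). It then
passes through a step by one Hölder inequality in the noise variable, with no density to compute
after the step.

What remains is to choose the amounts `a`. Cancelling a displacement `b` over `s` steps costs at
best `b² θ_L(s)` (`block_cost`). For (a), each epoch ends with displacement zero, so every later
epoch pays only for its own perturbation (`epoch_cost`). For (b), the whole displacement is absorbed
at every step; the coupled points then coincide, so the slack `ζ` in the Lipschitz bound never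
enters. -/

namespace ProxDiv

/-! ### The proximal operator: existence, nonexpansiveness, measurability. -/

section Prox

variable {n : ℕ} {ψ : EuclideanSpace ℝ (Fin n) → EReal}

lemma IsClosedConvexProper.measurableSet_effDom (hψ : IsClosedConvexProper ψ) :
    MeasurableSet (effDom ψ) :=
  hψ.lsc.measurable measurableSet_Iio

lemma IsClosedConvexProper.exists_eq_coe (hψ : IsClosedConvexProper ψ)
    {z : EuclideanSpace ℝ (Fin n)} (hz : z ∈ effDom ψ) : ∃ r : ℝ, ψ z = r :=
  ⟨(ψ z).toReal, (EReal.coe_toReal (ne_of_lt hz) (hψ.ne_bot z)).symm⟩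

lemma IsClosedConvexProper.isClosed_epigraph (hψ : IsClosedConvexProper ψ) :
    IsClosed {p : EuclideanSpace ℝ (Fin n) × ℝ | ψ p.1 ≤ (p.2 : EReal)} :=
  hψ.lsc.isClosed_epigraph.preimage
    (f := fun p : EuclideanSpace ℝ (Fin n) × ℝ => (p.1, (p.2 : EReal)))
    (continuous_fst.prodMk (continuous_coe_real_ereal.comp continuous_snd))

lemma IsClosedConvexProper.exists_affine_minorant (hψ : IsClosedConvexProper ψ) :
    ∃ (g : StrongDual ℝ (EuclideanSpace ℝ (Fin n))) (k : ℝ),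
      ∀ z, ((g z + k : ℝ) : EReal) ≤ ψ z := by
  -- The point `(z₀, r - 1)` lies strictly below the graph, so the separating hyperplane cannot be
  -- vertical: its last coefficient is positive and the inequality can be solved for the height.
  obtain ⟨z₀, hz₀⟩ := hψ.proper
  obtain ⟨r, hr⟩ := hψ.exists_eq_coe hz₀
  obtain ⟨f, u, hu, hf⟩ := geometric_hahn_banach_point_closed hψ.convex hψ.isClosed_epigraph
    (x := (z₀, r - 1)) (by
      simp only [Set.mem_ofPred_eq, hr, EReal.coe_le_coe_iff]; linarith)
  set g := f.comp (ContinuousLinearMap.inl ℝ (EuclideanSpace ℝ (Fin n)) ℝ) with hg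
  set c := f (0, 1) with hc
  have hfe : ∀ z t, f (z, t) = g z + t * c := by
    intro z t
    have : (z, t) = (z, (0 : ℝ)) + t • ((0 : EuclideanSpace ℝ (Fin n)), (1 : ℝ)) := by simp
    rw [this, map_add, map_smul]; simp [hg, hc]
  have h1 := hf (z₀, r) (by simp [hr])
  rw [hfe] at h1 hu
  have hcpos : 0 < c := by nlinarith
  refine ⟨(-c⁻¹) • g, u / c, fun z => ?_⟩
  by_cases hz : z ∈ effDom ψ
  · obtain ⟨s, hs⟩ := hψ.exists_eq_coe hz
    have h2 := hf (z, s) (by simp [hs])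
    rw [hfe] at h2
    rw [hs, EReal.coe_le_coe_iff]
    have : ((-c⁻¹) • g) z + u / c = (u - g z) / c := by
      simp; field_simp; ring
    rw [this, div_le_iff₀ hcpos]; linarith
  · have : ψ z = ⊤ := not_lt_top_iff.1 hz
    simp [this]

lemma IsClosedConvexProper.lsc_proxObjective (hψ : IsClosedConvexProper ψ)
    (z₀ : EuclideanSpace ℝ (Fin n)) : LowerSemicontinuous (proxObjective ψ z₀) := by
  refine hψ.lsc.add' (Continuous.lowerSemicontinuous (continuous_coe_real_ereal.comp (by fun_prop))) fun z => ?_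
  exact EReal.continuousAt_add (Or.inr (EReal.coe_ne_bot _)) (Or.inr (EReal.coe_ne_top _))

lemma IsClosedConvexProper.exists_minimizer (hψ : IsClosedConvexProper ψ)
    (z₀ : EuclideanSpace ℝ (Fin n)) :
    ∃ z, ∀ w, proxObjective ψ z₀ z ≤ proxObjective ψ z₀ w := by
  obtain ⟨z₁, hz₁⟩ := hψ.proper
  obtain ⟨r, hr⟩ := hψ.exists_eq_coe hz₁
  obtain ⟨g, k, hg⟩ := hψ.exists_affine_minorant
  set M : ℝ := r + ‖z₁ - z₀‖ ^ 2 / 2 with hM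
  have hM1 : proxObjective ψ z₀ z₁ = (M : EReal) := by
    rw [proxObjective, hr, hM, EReal.coe_add]
  set S := {z | proxObjective ψ z₀ z ≤ (M : EReal)} with hS
  have hSne : S.Nonempty := ⟨z₁, hM1.le⟩
  have hSclosed : IsClosed S := (hψ.lsc_proxObjective z₀).isClosed_preimage _
  -- Beyond this radius the quadratic term outweighs the affine minorant: `d² / 2 - ‖g‖ d > |M - k -
  -- g z₀|`.
  have hSbdd : S ⊆ Metric.closedBall z₀ (2 * ‖g‖ + 1 + 2 * |M - k - g z₀|) := by
    intro z hz
    have h1 : ((g z + k + ‖z - z₀‖ ^ 2 / 2 : ℝ) : EReal) ≤ M := by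
      refine le_trans ?_ hz
      rw [EReal.coe_add]
      exact add_le_add_left (hg z) _
    rw [EReal.coe_le_coe_iff] at h1
    have h2 : -(‖g‖ * ‖z - z₀‖) ≤ g z - g z₀ := by
      rw [← map_sub]
      have := g.le_opNorm (z - z₀)
      rw [Real.norm_eq_abs] at this
      linarith [neg_abs_le (g (z - z₀))]
    rw [mem_closedBall_iff_norm]
    by_contra! hcon
    have h3 := le_abs_self (M - k - g z₀)
    have h4 := abs_nonneg (M - k - g z₀)
    have h5 := norm_nonneg g
    nlinarith
  have hScomp : IsCompact S := (isCompact_closedBall _ _).of_isClosed_subset hSclosed hSbdd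
  obtain ⟨a, haS, ha⟩ := ((hψ.lsc_proxObjective z₀).lowerSemicontinuousOn S).exists_isMinOn
    hSne hScomp
  refine ⟨a, fun w => ?_⟩
  by_cases hw : w ∈ S
  · exact ha hw
  · exact haS.trans (not_le.1 hw).le

lemma IsClosedConvexProper.prox_le (hψ : IsClosedConvexProper ψ)
    (z₀ w : EuclideanSpace ℝ (Fin n)) :
    proxObjective ψ z₀ (prox ψ z₀) ≤ proxObjective ψ z₀ w :=
  Classical.epsilon_spec (hψ.exists_minimizer z₀) w

lemma IsClosedConvexProper.prox_mem (hψ : IsClosedConvexProper ψ)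
    (z₀ : EuclideanSpace ℝ (Fin n)) : prox ψ z₀ ∈ effDom ψ := by
  obtain ⟨z₁, hz₁⟩ := hψ.proper
  obtain ⟨r, hr⟩ := hψ.exists_eq_coe hz₁
  by_contra hcon
  have h1 : ψ (prox ψ z₀) = ⊤ := not_lt_top_iff.1 hcon
  have h2 := hψ.prox_le z₀ z₁
  rw [proxObjective, proxObjective, h1, hr, EReal.top_add_coe, ← EReal.coe_add] at h2
  exact absurd h2 (not_le.2 (EReal.coe_lt_top _))

/-- This is the subgradient relation `x - p ∈ ∂ψ(p)` at `p = prox ψ x`. Minimality is tested along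
the segment from `p` to `q`, divided by `t`, and `t` tends to `0`. -/
lemma IsClosedConvexProper.prox_variational (hψ : IsClosedConvexProper ψ)
    (x q : EuclideanSpace ℝ (Fin n)) {rp rq : ℝ} (hp : ψ (prox ψ x) = rp) (hq : ψ q = rq) :
    rp - rq ≤ inner ℝ (prox ψ x - x) (q - prox ψ x) := by
  set p := prox ψ x with hpdef
  have key : ∀ t : ℝ, 0 < t → t < 1 →
      rp - rq ≤ inner ℝ (p - x) (q - p) + t * (‖q - p‖ ^ 2 / 2) := by
    intro t ht0 ht1
    have hmem := hψ.convex (x := (p, rp)) (by simp [hp]) (y := (q, rq)) (by simp [hq])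
      (sub_nonneg.2 ht1.le) ht0.le (by ring)
    simp only [Prod.smul_mk, Prod.mk_add_mk, Set.mem_ofPred_eq, smul_eq_mul] at hmem
    have h1 := hψ.prox_le x ((1 - t) • p + t • q)
    rw [← hpdef, proxObjective, hp, ← EReal.coe_add] at h1
    have h2 := h1.trans (add_le_add_left hmem _)
    rw [← EReal.coe_add, EReal.coe_le_coe_iff] at h2
    have h3 : (1 - t) • p + t • q - x = (p - x) + t • (q - p) := by module
    rw [h3, norm_add_sq_real, inner_smul_right, norm_smul, mul_pow, Real.norm_eq_abs, sq_abs] at h2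
    have : t * (rp - rq) ≤ t * (inner ℝ (p - x) (q - p) + t * (‖q - p‖ ^ 2 / 2)) := by nlinarith
    exact le_of_mul_le_mul_left this ht0
  have hlim : Filter.Tendsto
      (fun t : ℝ => inner ℝ (p - x) (q - p) + t * (‖q - p‖ ^ 2 / 2))
      (nhdsWithin 0 (Set.Ioi 0)) (nhds (inner ℝ (p - x) (q - p) + 0 * (‖q - p‖ ^ 2 / 2))) :=
    (Continuous.tendsto (by fun_prop) 0).mono_left nhdsWithin_le_nhds
  rw [zero_mul, add_zero] at hlim
  refine ge_of_tendsto hlim ?_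
  filter_upwards [Ioo_mem_nhdsGT (zero_lt_one (α := ℝ))] with t ht using key t ht.1 ht.2

/-- Adding the variational inequalities at the two points gives `‖p - q‖² ≤ ⟪x - y, p - q⟫`;
Cauchy–Schwarz concludes. -/
lemma IsClosedConvexProper.norm_prox_sub_le (hψ : IsClosedConvexProper ψ)
    (x y : EuclideanSpace ℝ (Fin n)) : ‖prox ψ x - prox ψ y‖ ≤ ‖x - y‖ := by
  obtain ⟨rp, hp⟩ := hψ.exists_eq_coe (hψ.prox_mem x)
  obtain ⟨rq, hq⟩ := hψ.exists_eq_coe (hψ.prox_mem y)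
  have h1 := hψ.prox_variational x _ hp hq
  have h2 := hψ.prox_variational y _ hq hp
  set p := prox ψ x
  set q := prox ψ y
  have h3 : inner ℝ (p - x) (q - p) + inner ℝ (q - y) (p - q) =
      inner ℝ (x - y) (p - q) - ‖p - q‖ ^ 2 := by
    rw [← real_inner_self_eq_norm_sq, ← neg_sub p q, inner_neg_right, ← sub_eq_neg_add,
      ← inner_sub_left, ← inner_sub_left]
    congr 1; abel
  have h4 := real_inner_le_norm (x - y) (p - q)
  have h5 : ‖p - q‖ * ‖p - q‖ ≤ ‖x - y‖ * ‖p - q‖ := by nlinarith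
  rcases (norm_nonneg (p - q)).eq_or_lt with h | h
  · rw [← h]; exact norm_nonneg _
  · exact le_of_mul_le_mul_right h5 h

lemma IsClosedConvexProper.measurable_prox (hψ : IsClosedConvexProper ψ) :
    Measurable (prox ψ) :=
  (LipschitzWith.of_dist_le_mul (K := 1) fun x y => by
    simpa [dist_eq_norm] using hψ.norm_prox_sub_le x y).continuous.measurable

end Prox

/-! ### Shifting a Gaussian and the cost of the shift. -/

section Gaussian

variable {n : ℕ}

/-- Characteristic functions are compared. The value of `C` is left open because only ratios of
shifted densities matter. -/
lemma exists_gaussian_density {σ : ℝ} (hσ : 0 < σ) : ∃ C : ℝ, 0 < C ∧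
    multivariateGaussian 0 (σ ^ 2 • (1 : Matrix (Fin n) (Fin n) ℝ)) =
      (volume : Measure (EuclideanSpace ℝ (Fin n))).withDensity
        fun z => ENNReal.ofReal (C * Real.exp (-(1 / (2 * σ ^ 2)) * ‖z‖ ^ 2)) := by
  set b : ℝ := 1 / (2 * σ ^ 2) with hb
  have hb0 : 0 < b := by positivity
  set J : ℝ := (Real.pi / b) ^ ((n : ℝ) / 2) with hJ
  have hJ0 : 0 < J := by positivity
  have hint : ∫ z : EuclideanSpace ℝ (Fin n), Real.exp (-b * ‖z‖ ^ 2) = J := by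
    simpa [hJ] using
      GaussianFourier.integral_rexp_neg_mul_sq_norm (V := EuclideanSpace ℝ (Fin n)) hb0
  -- A non-integrable function has integral `0` by convention, whereas this integral is `J > 0`.
  have hintegrable : Integrable fun z : EuclideanSpace ℝ (Fin n) => Real.exp (-b * ‖z‖ ^ 2) := by
    by_contra hcon
    rw [integral_undef hcon] at hint
    exact hJ0.ne hint
  refine ⟨J⁻¹, inv_pos.2 hJ0, ?_⟩
  have hfin := isFiniteMeasure_withDensity_ofReal (hintegrable.const_mul J⁻¹).2
  refine Measure.ext_of_charFun ?_
  ext t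
  have hpsd : (σ ^ 2 • (1 : Matrix (Fin n) (Fin n) ℝ)).PosSemidef :=
    Matrix.PosSemidef.one.smul (sq_nonneg σ)
  rw [charFun_multivariateGaussian hpsd, charFun_apply,
    integral_withDensity_eq_integral_toReal_smul (by fun_prop) (by simp)]
  have h1 : ∀ z : EuclideanSpace ℝ (Fin n),
      (ENNReal.ofReal (J⁻¹ * Real.exp (-b * ‖z‖ ^ 2))).toReal •
        Complex.exp (inner ℝ z t * Complex.I) =
      (J : ℂ)⁻¹ * Complex.exp (-(b : ℂ) * ‖z‖ ^ 2 + Complex.I * inner ℝ t z) := by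
    intro z
    rw [ENNReal.toReal_ofReal (by positivity), Complex.exp_add, real_inner_comm]
    simp only [Complex.real_smul]
    push_cast
    ring_nf
  simp_rw [h1]
  rw [integral_const_mul, GaussianFourier.integral_cexp_neg_mul_sq_norm_add (by simpa using hb0)]
  have h2 : ((Real.pi : ℂ) / b) ^ ((Module.finrank ℝ (EuclideanSpace ℝ (Fin n)) : ℂ) / 2) = J := by
    rw [hJ, ← Complex.ofReal_div, Complex.ofReal_cpow (by positivity)]
    simp
  rw [h2, ← mul_assoc, inv_mul_cancel₀ (by exact_mod_cast hJ0.ne'), one_mul]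
  congr 1
  have h3 : (b : ℂ) = 1 / (2 * σ ^ 2) := by rw [hb]; push_cast; rfl
  have h4 : (σ : ℂ) ≠ 0 := by exact_mod_cast hσ.ne'
  rw [h3]
  have h5 : t.ofLp ⬝ᵥ (σ ^ 2 • (1 : Matrix (Fin n) (Fin n) ℝ)).mulVec t.ofLp =
      σ ^ 2 * ‖t‖ ^ 2 := by
    rw [Matrix.smul_mulVec, Matrix.one_mulVec, dotProduct_smul, EuclideanSpace.real_norm_sq_eq]
    simp [dotProduct, sq]
  rw [h5]
  simp only [inner_zero_right, Complex.I_sq]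
  push_cast
  field_simp
  ring

lemma lintegral_gaussian_add {σ : ℝ} (hσ : 0 < σ) (v : EuclideanSpace ℝ (Fin n))
    {h : EuclideanSpace ℝ (Fin n) → ℝ≥0∞} (hh : Measurable h) :
    ∫⁻ z, h (z + v) ∂multivariateGaussian 0 (σ ^ 2 • (1 : Matrix (Fin n) (Fin n) ℝ)) =
      ∫⁻ z, ENNReal.ofReal (Real.exp (inner ℝ v z / σ ^ 2 - ‖v‖ ^ 2 / (2 * σ ^ 2))) * h z
        ∂multivariateGaussian 0 (σ ^ 2 • (1 : Matrix (Fin n) (Fin n) ℝ)) := by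
  obtain ⟨C, hC, hN⟩ := exists_gaussian_density (n := n) hσ
  rw [hN, lintegral_withDensity_eq_lintegral_mul _ (by fun_prop) (by fun_prop),
    lintegral_withDensity_eq_lintegral_mul _ (by fun_prop) (by fun_prop),
    ← lintegral_sub_right_eq_self _ v]
  refine lintegral_congr fun z => ?_
  simp only [Pi.mul_apply, sub_add_cancel]
  rw [← mul_assoc, ← ENNReal.ofReal_mul (by positivity), mul_assoc, ← Real.exp_add]
  congr 4
  rw [norm_sub_sq_real, real_inner_comm]
  field_simp
  ring

/-- Hölder is applied to the Cameron–Martin density of the shift `v`. Its `α`-th power is a constant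
times the density of the shift `α • v`, which has mass one. -/
lemma lintegral_gaussian_add_le {σ α β : ℝ} (hσ : 0 < σ) (hαβ : α.HolderConjugate β)
    (v : EuclideanSpace ℝ (Fin n)) {h : EuclideanSpace ℝ (Fin n) → ℝ≥0∞} (hh : Measurable h) :
    ∫⁻ z, h (z + v) ∂multivariateGaussian 0 (σ ^ 2 • (1 : Matrix (Fin n) (Fin n) ℝ)) ≤
      ENNReal.ofReal (Real.exp ((α - 1) / (2 * σ ^ 2) * ‖v‖ ^ 2)) *
        (∫⁻ z, h z ^ β
          ∂multivariateGaussian 0 (σ ^ 2 • (1 : Matrix (Fin n) (Fin n) ℝ))) ^ (1 / β) := by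
  rw [lintegral_gaussian_add hσ v hh]
  refine (ENNReal.lintegral_mul_le_Lp_mul_Lq _ hαβ (by fun_prop) (by fun_prop)).trans_eq ?_
  congr 1
  have h1 := lintegral_gaussian_add hσ (α • v)
    (h := fun _ => 1) measurable_const
  simp only [lintegral_one, measure_univ, mul_one] at h1
  have h2 : ∀ z : EuclideanSpace ℝ (Fin n),
      ENNReal.ofReal (Real.exp (inner ℝ v z / σ ^ 2 - ‖v‖ ^ 2 / (2 * σ ^ 2))) ^ α =
      ENNReal.ofReal (Real.exp (α * ((α - 1) / (2 * σ ^ 2) * ‖v‖ ^ 2))) * ENNReal.ofReal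
        (Real.exp (inner ℝ (α • v) z / σ ^ 2 - ‖α • v‖ ^ 2 / (2 * σ ^ 2))) := by
    intro z
    rw [ENNReal.ofReal_rpow_of_pos (Real.exp_pos _), ← Real.exp_mul,
      ← ENNReal.ofReal_mul (Real.exp_pos _).le, ← Real.exp_add, real_inner_smul_left, norm_smul,
      mul_pow, Real.norm_eq_abs, sq_abs]
    congr 2
    ring
  simp_rw [h2]
  rw [lintegral_const_mul _ (by fun_prop), ← h1, mul_one,
    ENNReal.ofReal_rpow_of_pos (Real.exp_pos _), ← Real.exp_mul]
  congr 2
  have := hαβ.ne_zero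
  field_simp

end Gaussian

/-! ### Rényi divergence as a dual `L^α` bound. -/

section Dual

variable {n : ℕ}

/-- The bound `‖dγ/dν‖_{L^α(ν)} ≤ exp c` in dual form, where `β` is the exponent conjugate
to `α`. -/
def DualBound {X : Type*} [MeasurableSpace X] (β c : ℝ) (γ ν : Measure X) : Prop :=
  ∀ h : X → ℝ≥0∞, Measurable h →
    ∫⁻ x, h x ∂γ ≤ ENNReal.ofReal (Real.exp c) * (∫⁻ x, h x ^ β ∂ν) ^ (1 / β)

lemma DualBound.absolutelyContinuous {X : Type*} [MeasurableSpace X] {β c : ℝ}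
    {γ ν : Measure X} (hβ : 0 < β) (h : DualBound β c γ ν) : γ ≪ ν := by
  refine Measure.AbsolutelyContinuous.mk fun s hs hνs => ?_
  have h1 := h (s.indicator 1) (measurable_one.indicator hs)
  have h2 : ∀ x, s.indicator (1 : X → ℝ≥0∞) x ^ β = s.indicator 1 x := fun x => by
    by_cases hx : x ∈ s <;> simp [hx, hβ]
  simp_rw [h2] at h1
  rw [lintegral_indicator_one hs, lintegral_indicator_one hs, hνs,
    ENNReal.zero_rpow_of_pos (by positivity), mul_zero] at h1
  exact le_antisymm h1 zero_le

/-- The extremal test function in Hölder is `f ^ (α - 1)`. Truncating `f` at `m` makes the integral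
finite, so that its power can be cancelled; monotone convergence removes the truncation. -/
lemma DualBound.lintegral_rnDeriv_rpow_le {X : Type*} [MeasurableSpace X] {α β c : ℝ}
    {γ ν : Measure X} [IsFiniteMeasure γ] [IsFiniteMeasure ν]
    (hαβ : α.HolderConjugate β) (h : DualBound β c γ ν) :
    ∫⁻ x, γ.rnDeriv ν x ^ α ∂ν ≤ ENNReal.ofReal (Real.exp (α * c)) := by
  have hac := h.absolutelyContinuous hαβ.symm.pos
  have hα := hαβ.pos
  set f := γ.rnDeriv ν with hf
  have hfm : Measurable f := Measure.measurable_rnDeriv _ _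
  have hα1 : 0 < α - 1 := sub_pos.2 hαβ.lt
  have key : ∀ m : ℕ, ∫⁻ x, (min (f x) m) ^ α ∂ν ≤ ENNReal.ofReal (Real.exp (α * c)) := by
    intro m
    set I := ∫⁻ x, (min (f x) m) ^ α ∂ν with hI
    have hItop : I ≠ ⊤ := by
      refine ne_top_of_le_ne_top (b := ∫⁻ _, (m : ℝ≥0∞) ^ α ∂ν) ?_
        (lintegral_mono fun x => ENNReal.rpow_le_rpow (min_le_right _ _) hα.le)
      rw [lintegral_const]
      exact ENNReal.mul_ne_top (ENNReal.rpow_ne_top_of_nonneg hα.le (by simp)) (by simp)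
    have h1 := h (fun x => (min (f x) m) ^ (α - 1)) (by fun_prop)
    have h2 : ∀ x, ((min (f x) (m : ℝ≥0∞)) ^ (α - 1)) ^ β = (min (f x) m) ^ α := fun x => by
      rw [← ENNReal.rpow_mul, hαβ.sub_one_mul_conj]
    simp_rw [h2] at h1
    rw [← Measure.withDensity_rnDeriv_eq γ ν hac,
      lintegral_withDensity_eq_lintegral_mul _ hfm (by fun_prop)] at h1
    have h3 : I ≤ ∫⁻ x, (f * fun x => (min (f x) (m : ℝ≥0∞)) ^ (α - 1)) x ∂ν := by
      refine lintegral_mono fun x => ?_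
      simp only [Pi.mul_apply]
      calc (min (f x) (m : ℝ≥0∞)) ^ α = (min (f x) m) ^ (1 + (α - 1)) := by ring_nf
        _ = min (f x) m * (min (f x) m) ^ (α - 1) := by
          rw [ENNReal.rpow_add_of_nonneg _ _ zero_le_one hα1.le, ENNReal.rpow_one]
        _ ≤ _ := by gcongr; exact min_le_left _ _
    have h4 := h3.trans h1
    rcases eq_or_ne I 0 with h0 | h0
    · rw [h0]; exact zero_le
    have hI1 : I ^ (1 / α) * I ^ (1 / β) = I := by
      rw [← ENNReal.rpow_add _ _ h0 hItop, one_div, one_div, hαβ.inv_add_inv_eq_one,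
        ENNReal.rpow_one]
    have h5 : I ^ (1 / α) * I ^ (1 / β) ≤ ENNReal.ofReal (Real.exp c) * I ^ (1 / β) := by
      rw [hI1]; exact h4
    have hβ := hαβ.symm.pos
    have h6 : I ^ (1 / α) ≤ ENNReal.ofReal (Real.exp c) :=
      (ENNReal.mul_le_mul_iff_left (ENNReal.rpow_pos (pos_iff_ne_zero.2 h0) hItop).ne'
        (ENNReal.rpow_ne_top_of_nonneg (by positivity) hItop)).1 h5
    have h7 := ENNReal.rpow_le_rpow h6 hα.le
    rwa [← ENNReal.rpow_mul, one_div, inv_mul_cancel₀ hα.ne', ENNReal.rpow_one,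
      ENNReal.ofReal_rpow_of_pos (Real.exp_pos _), ← Real.exp_mul, mul_comm c] at h7
  have hsup : ∀ x, f x ^ α = ⨆ m : ℕ, (min (f x) m) ^ α := by
    intro x
    have : f x = ⨆ m : ℕ, min (f x) (m : ℝ≥0∞) := by
      rw [← inf_iSup_eq, ENNReal.iSup_natCast, inf_top_eq]
    conv_lhs => rw [this]
    exact (ENNReal.orderIsoRpow α hα).map_iSup _
  simp_rw [hsup]
  rw [lintegral_iSup (fun m => by fun_prop)]
  · exact iSup_le key
  · intro m k hmk x
    exact ENNReal.rpow_le_rpow (min_le_min le_rfl (by exact_mod_cast hmk)) hα.le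

lemma DualBound.renyiDiv_le {α β c : ℝ} {γ ν : Measure (EuclideanSpace ℝ (Fin n))}
    [IsFiniteMeasure γ] [IsFiniteMeasure ν] (hαβ : α.HolderConjugate β)
    (h : DualBound β c γ ν) : renyiDiv α γ ν ≤ ((α / (α - 1) * c : ℝ) : EReal) := by
  have hα1 : 0 < α - 1 := sub_pos.2 hαβ.lt
  rw [renyiDiv, if_pos (h.absolutelyContinuous hαβ.symm.pos)]
  have h1 := ENNReal.log_le_log (h.lintegral_rnDeriv_rpow_le hαβ)
  rw [ENNReal.log_ofReal_of_pos (Real.exp_pos _), Real.log_exp] at h1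
  have h2 : (0 : EReal) ≤ (((α - 1)⁻¹ : ℝ) : EReal) := by exact_mod_cast (inv_pos.2 hα1).le
  refine (mul_le_mul_of_nonneg_left h1 h2).trans_eq ?_
  rw [← EReal.coe_mul]
  congr 1
  field_simp

lemma exists_dualBound_of_renyiDiv_ne_top {α β : ℝ} {γ ν : Measure (EuclideanSpace ℝ (Fin n))}
    [IsProbabilityMeasure γ] [IsFiniteMeasure ν] (hαβ : α.HolderConjugate β)
    (h : renyiDiv α γ ν ≠ ⊤) :
    ∃ c : ℝ, renyiDiv α γ ν = ((α / (α - 1) * c : ℝ) : EReal) ∧ DualBound β c γ ν := by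
  have hα1 : 0 < α - 1 := sub_pos.2 hαβ.lt
  have hα := hαβ.pos
  have hac : γ ≪ ν := by
    by_contra hcon
    exact h (if_neg hcon)
  have hr : renyiDiv α γ ν = (((α - 1)⁻¹ : ℝ) : EReal) *
      ENNReal.log (∫⁻ x, (γ.rnDeriv ν x) ^ α ∂ν) := if_pos hac
  set I := ∫⁻ x, (γ.rnDeriv ν x) ^ α ∂ν with hI
  have hItop : I ≠ ⊤ := by
    intro hcon
    rw [hr, hcon, ENNReal.log_top, EReal.coe_mul_top_of_pos (inv_pos.2 hα1)] at h
    exact h rfl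
  have hholder : ∀ h : EuclideanSpace ℝ (Fin n) → ℝ≥0∞, Measurable h →
      ∫⁻ x, h x ∂γ ≤ I ^ (1 / α) * (∫⁻ x, h x ^ β ∂ν) ^ (1 / β) := by
    intro h hh
    have := Measure.haveLebesgueDecomposition_of_sigmaFinite γ ν
    have hγ : ν.withDensity (γ.rnDeriv ν) = γ := Measure.withDensity_rnDeriv_eq γ ν hac
    conv_lhs => rw [← hγ, lintegral_withDensity_eq_lintegral_mul _ (Measure.measurable_rnDeriv _ _) hh]
    exact ENNReal.lintegral_mul_le_Lp_mul_Lq _ hαβ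
      (Measure.measurable_rnDeriv _ _).aemeasurable hh.aemeasurable
  -- Testing with `1` would give `1 ≤ 0`. Together with `hItop` this makes `log I` a real number.
  have hI0 : I ≠ 0 := by
    intro hcon
    have := hholder 1 measurable_one
    rw [hcon, ENNReal.zero_rpow_of_pos (by positivity), zero_mul] at this
    simp at this
  have hIpos : 0 < I.toReal := ENNReal.toReal_pos hI0 hItop
  refine ⟨1 / α * Real.log I.toReal, ?_, ?_⟩
  · rw [hr, ENNReal.log_pos_real hI0 hItop, ← EReal.coe_mul]
    congr 1
    field_simp
  · have : ENNReal.ofReal (Real.exp (1 / α * Real.log I.toReal)) = I ^ (1 / α) := by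
      rw [mul_comm, Real.exp_mul, Real.exp_log hIpos, ← ENNReal.ofReal_rpow_of_pos hIpos,
        ENNReal.ofReal_toReal hItop]
    intro h hh
    rw [this]
    exact hholder h hh

end Dual

/-! ### One step of the process under a shifted dual bound. -/

section Coupling

variable {n : ℕ}

/-- The law of `prox ψ (f X + Z)` for independent `X ∼ μ` and `Z ∼ N(0, σ² I)`. -/
noncomputable def lawStep (ψ : EuclideanSpace ℝ (Fin n) → EReal) (σ : ℝ)
    (f : EuclideanSpace ℝ (Fin n) → EuclideanSpace ℝ (Fin n))
    (μ : Measure (EuclideanSpace ℝ (Fin n))) : Measure (EuclideanSpace ℝ (Fin n)) :=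
  (μ.prod (multivariateGaussian 0 (σ ^ 2 • (1 : Matrix (Fin n) (Fin n) ℝ)))).map
    fun p => prox ψ (f p.1 + p.2)

/-- `μ` can be coupled within distance `τ` to a measure that satisfies the dual bound
relative to `ν`. -/
def ShiftedDualBound (β c τ : ℝ) (μ ν : Measure (EuclideanSpace ℝ (Fin n))) : Prop :=
  ∃ π : Measure (EuclideanSpace ℝ (Fin n) × EuclideanSpace ℝ (Fin n)), IsProbabilityMeasure π ∧
    π.map Prod.fst = μ ∧ (∀ᵐ p ∂π, ‖p.1 - p.2‖ ≤ τ) ∧ DualBound β c (π.map Prod.snd) ν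

lemma ShiftedDualBound.dualBound {β c : ℝ} {μ ν : Measure (EuclideanSpace ℝ (Fin n))}
    (h : ShiftedDualBound β c 0 μ ν) : DualBound β c μ ν := by
  obtain ⟨π, -, hμ, hd, hb⟩ := h
  have : π.map Prod.fst = π.map Prod.snd := Measure.map_congr <| by
    filter_upwards [hd] with p hp using sub_eq_zero.1 (norm_le_zero_iff.1 hp)
  rwa [← hμ, this]

/-- For fixed `x`, the Gaussian shift bound replaces the inner integral by `H (Y x)`, where `H` is
the `L^β` norm of the test function in the noise. The hypothesis tested on `H` finishes, since `H ^
β` integrates to the `β`-th moment under `lawStep`. The shift `V` may depend on all of `x`, not only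
on `Y x`, as the coupling requires. -/
lemma DualBound.lawStep_of_shift {α β σ c a : ℝ} (hσ : 0 < σ) (hαβ : α.HolderConjugate β)
    {X : Type*} [MeasurableSpace X] {π : Measure X} [IsFiniteMeasure π]
    {ψ : EuclideanSpace ℝ (Fin n) → EReal} (hprox : Measurable (prox ψ))
    {ν : Measure (EuclideanSpace ℝ (Fin n))} [SFinite ν]
    {g : EuclideanSpace ℝ (Fin n) → EuclideanSpace ℝ (Fin n)} (hg : Measurable g)
    {Y V : X → EuclideanSpace ℝ (Fin n)} (hY : Measurable Y) (hV : Measurable V)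
    (hVa : ∀ᵐ x ∂π, ‖V x‖ ≤ a) (h : DualBound β c (π.map Y) ν) :
    DualBound β (c + (α - 1) / (2 * σ ^ 2) * a ^ 2)
      ((π.prod (multivariateGaussian 0 (σ ^ 2 • (1 : Matrix (Fin n) (Fin n) ℝ)))).map
        fun q => prox ψ (g (Y q.1) + V q.1 + q.2)) (lawStep ψ σ g ν) := by
  intro k hk
  set N := multivariateGaussian 0 (σ ^ 2 • (1 : Matrix (Fin n) (Fin n) ℝ)) with hN
  have hα1 : 0 < α - 1 := sub_pos.2 hαβ.lt
  have hβ := hαβ.symm.pos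
  have hm : Measurable fun q : X × EuclideanSpace ℝ (Fin n) =>
      prox ψ (g (Y q.1) + V q.1 + q.2) := hprox.comp (by fun_prop)
  have hm' : Measurable fun q : EuclideanSpace ℝ (Fin n) × EuclideanSpace ℝ (Fin n) =>
      prox ψ (g q.1 + q.2) := hprox.comp (by fun_prop)
  have hkm : Measurable fun q : X × EuclideanSpace ℝ (Fin n) =>
      k (prox ψ (g (Y q.1) + V q.1 + q.2)) := hk.comp hm
  have hkm' : Measurable fun q : EuclideanSpace ℝ (Fin n) × EuclideanSpace ℝ (Fin n) =>
      k (prox ψ (g q.1 + q.2)) ^ β := (hk.comp hm').pow_const β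
  set H : EuclideanSpace ℝ (Fin n) → ℝ≥0∞ :=
    fun y => (∫⁻ z, k (prox ψ (g y + z)) ^ β ∂N) ^ (1 / β) with hH
  have hHm : Measurable H := by
    have : Measurable fun y => ∫⁻ z, k (prox ψ (g y + z)) ^ β ∂N :=
      hkm'.lintegral_prod_right'
    exact this.pow_const _
  rw [lintegral_map hk hm, lintegral_prod _ hkm.aemeasurable]
  have h1 : ∀ᵐ x ∂π, ∫⁻ z, k (prox ψ (g (Y x) + V x + z)) ∂N ≤
      ENNReal.ofReal (Real.exp ((α - 1) / (2 * σ ^ 2) * a ^ 2)) * H (Y x) := by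
    filter_upwards [hVa] with x hx
    have h2 := lintegral_gaussian_add_le hσ hαβ (V x)
      (h := fun z => k (prox ψ (g (Y x) + z))) (hk.comp (hprox.comp (by fun_prop)))
    have h3 : ∀ z, g (Y x) + V x + z = g (Y x) + (z + V x) := fun z => by abel
    simp_rw [h3]
    refine h2.trans ?_
    gcongr
  have h4 : ∀ y, H y ^ β = ∫⁻ z, k (prox ψ (g y + z)) ^ β ∂N := fun y => by
    rw [hH, ← ENNReal.rpow_mul, one_div, inv_mul_cancel₀ hβ.ne', ENNReal.rpow_one]
  have h5 := h H hHm
  simp_rw [h4] at h5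
  rw [lintegral_map hHm hY] at h5
  calc ∫⁻ x, ∫⁻ z, k (prox ψ (g (Y x) + V x + z)) ∂N ∂π
      ≤ ∫⁻ x, ENNReal.ofReal (Real.exp ((α - 1) / (2 * σ ^ 2) * a ^ 2)) * H (Y x) ∂π :=
        lintegral_mono_ae h1
    _ = ENNReal.ofReal (Real.exp ((α - 1) / (2 * σ ^ 2) * a ^ 2)) * ∫⁻ x, H (Y x) ∂π :=
        lintegral_const_mul _ (hHm.comp hY)
    _ ≤ _ := mul_le_mul_right h5 _
    _ = _ := by
        rw [← mul_assoc, ← ENNReal.ofReal_mul (Real.exp_pos _).le, ← Real.exp_add,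
          add_comm (_ * a ^ 2) c, lawStep, lintegral_map (hk.pow_const β) hm',
          lintegral_prod _ hkm'.aemeasurable]

lemma ShiftedDualBound.step {α β σ a b c τ : ℝ} (hσ : 0 < σ) (hαβ : α.HolderConjugate β)
    {ψ : EuclideanSpace ℝ (Fin n) → EReal} (hψ : IsClosedConvexProper ψ)
    {f g : EuclideanSpace ℝ (Fin n) → EuclideanSpace ℝ (Fin n)}
    (hf : Measurable f) (hg : Measurable g)
    {μ ν : Measure (EuclideanSpace ℝ (Fin n))} [SFinite ν]
    (hμ : ∀ᵐ x ∂μ, x ∈ effDom ψ) (hν : ∀ᵐ x ∂ν, x ∈ effDom ψ)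
    (hfg : ∀ x ∈ effDom ψ, ∀ y ∈ effDom ψ, ‖x - y‖ ≤ τ → ‖f x - g y‖ ≤ b)
    (ha : 0 ≤ a) (hab : a ≤ b) (h : ShiftedDualBound β c τ μ ν) :
    ShiftedDualBound β (c + (α - 1) / (2 * σ ^ 2) * a ^ 2) (b - a)
      (lawStep ψ σ f μ) (lawStep ψ σ g ν) := by
  obtain ⟨π, hπ, hπμ, hd, hb⟩ := h
  have hprox := hψ.measurable_prox
  set N := multivariateGaussian 0 (σ ^ 2 • (1 : Matrix (Fin n) (Fin n) ℝ)) with hN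
  -- The shift moves the second point the fraction `a / b` of the way towards the first. Both points
  -- of the new coupling use the same noise. If `b = 0`, then `a / b = 0` by convention and the two
  -- points already agree.
  set V : EuclideanSpace ℝ (Fin n) × EuclideanSpace ℝ (Fin n) → EuclideanSpace ℝ (Fin n) :=
    fun p => (a / b) • (f p.1 - g p.2) with hV
  have hVm : Measurable V := by fun_prop
  have hgood : ∀ᵐ p ∂π, ‖f p.1 - g p.2‖ ≤ b := by
    have h1 : ∀ᵐ p ∂π, p.1 ∈ effDom ψ :=
      ae_of_ae_map measurable_fst.aemeasurable (hπμ ▸ hμ)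
    have h2 : ∀ᵐ p ∂π, p.2 ∈ effDom ψ :=
      ae_of_ae_map measurable_snd.aemeasurable
        ((hb.absolutelyContinuous hαβ.symm.pos).ae_le hν)
    filter_upwards [h1, h2, hd] with p hp1 hp2 hp using hfg _ hp1 _ hp2 hp
  have hb0 : 0 ≤ b := ha.trans hab
  have hm1 : Measurable fun q : (EuclideanSpace ℝ (Fin n) × EuclideanSpace ℝ (Fin n)) ×
      EuclideanSpace ℝ (Fin n) => prox ψ (f q.1.1 + q.2) := hprox.comp (by fun_prop)
  have hm2 : Measurable fun q : (EuclideanSpace ℝ (Fin n) × EuclideanSpace ℝ (Fin n)) ×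
      EuclideanSpace ℝ (Fin n) => prox ψ (g q.1.2 + V q.1 + q.2) := hprox.comp (by fun_prop)
  have hm := hm1.prodMk hm2
  have hprob := Measure.isProbabilityMeasure_map (μ := π.prod N) hm.aemeasurable
  refine ⟨_, hprob, ?_, ?_, ?_⟩
  · have hm' : Measurable fun p : EuclideanSpace ℝ (Fin n) × EuclideanSpace ℝ (Fin n) =>
        prox ψ (f p.1 + p.2) := hprox.comp (by fun_prop)
    rw [Measure.map_map measurable_fst hm, ProxDiv.lawStep, ← hπμ]
    conv_rhs => rw [← Measure.map_id (μ := multivariateGaussian _ _),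
      Measure.map_prod_map _ _ measurable_fst measurable_id, Measure.map_map hm' (by fun_prop)]
    rfl
  · rw [ae_map_iff hm.aemeasurable
      (measurableSet_le (by fun_prop) measurable_const)]
    filter_upwards [Measure.quasiMeasurePreserving_fst.ae hgood] with q hq
    refine (hψ.norm_prox_sub_le _ _).trans ?_
    rcases hb0.eq_or_lt with h0 | h0
    · have : a = 0 := le_antisymm (hab.trans h0.symm.le) ha
      rw [← h0, norm_le_zero_iff, sub_eq_zero] at hq
      simp [hV, ← h0, this, hq]
    · have h1 : f q.1.1 + q.2 - (g q.1.2 + V q.1 + q.2) =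
          (1 - a / b) • (f q.1.1 - g q.1.2) := by simp only [hV]; module
      have h2 : 0 ≤ 1 - a / b := sub_nonneg.2 ((div_le_one h0).2 hab)
      rw [h1, norm_smul, Real.norm_eq_abs, abs_of_nonneg h2]
      calc (1 - a / b) * ‖f q.1.1 - g q.1.2‖ ≤ (1 - a / b) * b := by gcongr
        _ = b - a := by field_simp
  · rw [Measure.map_map measurable_snd hm]
    refine DualBound.lawStep_of_shift hσ hαβ hprox hg measurable_snd hVm ?_ hb
    filter_upwards [hgood] with p hp
    rw [hV, norm_smul, Real.norm_eq_abs, abs_of_nonneg (by positivity)]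
    rcases hb0.eq_or_lt with h0 | h0
    · simpa [← h0] using ha
    · calc a / b * ‖f p.1 - g p.2‖ ≤ a / b * b := by gcongr
        _ = a := by field_simp

end Coupling

/-! ### Optimal allocation of the shifts over blocks and epochs. -/

section Theta

lemma theta_one (L : ℝ) : theta L 1 = 1 := by simp [theta]

lemma theta_nonneg (L : ℝ) (s : ℕ) : 0 ≤ theta L s := by
  unfold theta
  split_ifs
  · exact le_rfl
  · have : ∀ j, 0 ≤ L ^ (2 * j) := fun j => by rw [pow_mul]; positivity
    exact div_nonneg (this _) (Finset.sum_nonneg fun j _ => this j)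

/-- With `x = L² θ_L(s)`, the right side `x / (1 + x)` is the minimum of `a² + x (1 - a)²` over `a`.
The recursion fails at `s = 0`, where `θ_L(1) = 1`. -/
lemma theta_succ (L : ℝ) {s : ℕ} (hs : 1 ≤ s) :
    theta L (s + 1) = L ^ 2 * theta L s / (1 + L ^ 2 * theta L s) := by
  obtain ⟨k, rfl⟩ : ∃ k, s = k + 1 := ⟨s - 1, by omega⟩
  have hpos : 0 < ∑ j ∈ Finset.range (k + 1), L ^ (2 * j) := by
    rw [Finset.sum_range_succ']
    have : 0 ≤ ∑ j ∈ Finset.range k, L ^ (2 * (j + 1)) :=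
      Finset.sum_nonneg fun j _ => by rw [pow_mul]; positivity
    simp only [mul_zero, pow_zero]; linarith
  have hpow : 0 ≤ L ^ (2 * (k + 1)) := by rw [pow_mul]; positivity
  rw [theta, theta, if_neg (by omega), if_neg (by omega), Finset.sum_range_succ _ (k + 1)]
  simp only [Nat.add_sub_cancel]
  set S := ∑ j ∈ Finset.range (k + 1), L ^ (2 * j)
  have h1 : L ^ 2 * (L ^ (2 * k) / S) = L ^ (2 * (k + 1)) / S := by ring
  rw [h1]
  have : S + L ^ (2 * (k + 1)) ≠ 0 := by positivity
  field_simp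

/-- Spending the noise shifts optimally over `s` steps cancels a displacement `b`
at the cost `κ b² θ_L(s)`. -/
lemma block_cost {C : ℕ → ℝ → ℝ → Prop} {L κ : ℝ} (hL : 0 ≤ L) {s : ℕ} (hs : 1 ≤ s) :
    ∀ (m : ℕ) (b c : ℝ), 0 ≤ b →
      (∀ a, 0 ≤ a → a ≤ b → C (m + 1) (b - a) (c + κ * a ^ 2)) →
      (∀ t, m < t → t < m + s → ∀ τ c a, 0 ≤ τ → 0 ≤ a → a ≤ L * τ → C t τ c →
        C (t + 1) (L * τ - a) (c + κ * a ^ 2)) →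
      C (m + s) 0 (c + κ * (b ^ 2 * theta L s)) := by
  induction s, hs using Nat.le_induction with
  | base =>
    intro m b c hb h1 _
    simpa [theta_one] using h1 b hb le_rfl
  | succ s hs ih =>
    intro m b c hb h1 h2
    have hθ := theta_nonneg L (s + 1)
    have ht : 0 ≤ L ^ 2 * theta L s := mul_nonneg (sq_nonneg _) (theta_nonneg L s)
    have hθ1 : theta L (s + 1) ≤ 1 := by
      rw [theta_succ L hs]
      exact div_le_one_of_le₀ (by linarith) (by linarith)
    -- This is the minimizer of `a² + (L (b - a))² θ_L(s)`: the first shift plus the optimal cost of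
    -- the remaining `s` steps.
    set a := b * theta L (s + 1) with ha
    have ha0 : 0 ≤ a := mul_nonneg hb hθ
    have hab : a ≤ b := mul_le_of_le_one_right hb hθ1
    have h3 := ih (m + 1) (L * (b - a)) (c + κ * a ^ 2)
      (mul_nonneg hL (sub_nonneg.2 hab))
      (fun a' ha' hab' => h2 (m + 1) (by omega) (by omega) _ _ _ (sub_nonneg.2 hab) ha' hab'
        (h1 a ha0 hab))
      (fun t ht1 ht2 => h2 t (by omega) (by omega))
    have h4 : c + κ * a ^ 2 + κ * ((L * (b - a)) ^ 2 * theta L s) =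
        c + κ * (b ^ 2 * theta L (s + 1)) := by
      have h5 : a ^ 2 + (L * (b - a)) ^ 2 * theta L s = b ^ 2 * theta L (s + 1) := by
        have h6 : (L * (b - a)) ^ 2 * theta L s =
            b ^ 2 * (1 - theta L (s + 1)) ^ 2 * (L ^ 2 * theta L s) := by rw [ha]; ring
        rw [h6, ha, theta_succ L hs]
        generalize L ^ 2 * theta L s = x at ht
        have : 1 + x ≠ 0 := by positivity
        field_simp
        ring
      rw [← h5]; ring
    rw [h4] at h3
    rwa [show m + (s + 1) = m + 1 + s by omega]

/-- The total cost of a run of `T` steps with a perturbation of size `r` at the start of every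
epoch of `ℓ` steps. -/
lemma epoch_cost {C : ℕ → ℝ → ℝ → Prop} {L κ r τ c : ℝ} (hL : 0 ≤ L) (hr : 0 ≤ r) (hτ : 0 ≤ τ)
    {ℓ T : ℕ} (hℓ : 1 ≤ ℓ) (hℓT : ℓ ≤ T)
    (hstep : ∀ t < T, ∀ τ c a, 0 ≤ τ → 0 ≤ a → a ≤ L * τ + (if ℓ ∣ t then r else 0) → C t τ c →
      C (t + 1) (L * τ + (if ℓ ∣ t then r else 0) - a) (c + κ * a ^ 2))
    (h0 : C 0 τ c) :
    C T 0 (c + κ * ((L * τ + r) ^ 2 * theta L ℓ +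
      r ^ 2 * ((((T / ℓ : ℕ) : ℝ) - 1) * theta L ℓ + theta L (T - (T / ℓ) * ℓ)))) := by
  have hblock : ∀ (e s : ℕ) (τ c : ℝ), 0 ≤ τ → 1 ≤ s → s ≤ ℓ → e * ℓ + s ≤ T → C (e * ℓ) τ c →
      C (e * ℓ + s) 0 (c + κ * ((L * τ + r) ^ 2 * theta L s)) := by
    intro e s τ c hτ hs1 hs2 hs3 hC
    refine block_cost hL hs1 _ _ _ (by positivity) (fun a ha hab => ?_)
      (fun t ht1 ht2 τ c a hτ ha hab hC => ?_)
    · have := hstep (e * ℓ) (by omega) τ c a hτ ha (by simpa using hab) hC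
      simpa using this
    · have hnd : ¬ ℓ ∣ t := by
        rintro ⟨k, rfl⟩
        rw [mul_comm] at ht1
        have h1 : e < k := lt_of_mul_lt_mul_right' (by nlinarith : e * ℓ < k * ℓ)
        nlinarith
      have := hstep t (by omega) τ c a hτ ha (by simpa [hnd] using hab) hC
      simpa [hnd] using this
  -- The first epoch is counted apart, since it alone carries the initial displacement `τ`; the
  -- other `e` start from zero.
  have hepochs : ∀ e : ℕ, (e + 1) * ℓ ≤ T → C ((e + 1) * ℓ) 0
      (c + κ * ((L * τ + r) ^ 2 * theta L ℓ + r ^ 2 * (e * theta L ℓ))) := by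
    intro e
    induction e with
    | zero =>
      intro h
      have := hblock 0 ℓ τ c hτ hℓ le_rfl (by simpa using h) (by simpa using h0)
      simpa using this
    | succ e ih =>
      intro h
      have h1 : (e + 1) * ℓ + ℓ ≤ T := by linarith [h, show (e + 1 + 1) * ℓ = (e + 1) * ℓ + ℓ by ring]
      have := hblock (e + 1) ℓ 0 _ le_rfl hℓ le_rfl h1 (ih (by omega))
      rw [show (e + 1 + 1) * ℓ = (e + 1) * ℓ + ℓ by ring]
      convert this using 1
      push_cast
      ring
  obtain ⟨e, he⟩ : ∃ e, T / ℓ = e + 1 :=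
    ⟨T / ℓ - 1, by have := Nat.div_pos hℓT hℓ; omega⟩
  have hle : (e + 1) * ℓ ≤ T := he ▸ Nat.div_mul_le_self T ℓ
  have hlt : T < (e + 1) * ℓ + ℓ := by
    have := Nat.lt_div_mul_add (a := T) (b := ℓ) (by omega)
    rwa [he] at this
  have h1 := hepochs e hle
  rw [he]
  rcases hle.eq_or_lt with h2 | h2
  -- No incomplete epoch is left, in accordance with `theta L 0 = 0`.
  · rw [h2] at h1
    rw [h2, Nat.sub_self]
    convert h1 using 1
    simp [theta]
  · have := hblock (e + 1) (T - (e + 1) * ℓ) 0 _ le_rfl (by omega) (by omega) (by omega) h1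
    rw [Nat.add_sub_cancel' hle] at this
    convert this using 1
    push_cast
    ring

end Theta

/-! ### Laws of the iterates and independence of the later noise. -/

section Iterates

variable {n : ℕ} {Ω : Type*} [MeasurableSpace Ω] {P : Measure Ω}

/-- The joint law of the triple is a threefold product, which can be reassociated. -/
lemma indepFun_prodMk_left_of_right [IsFiniteMeasure P] {A B C : Type*} [MeasurableSpace A] [MeasurableSpace B]
    [MeasurableSpace C] {X : Ω → A} {Y : Ω → B} {W : Ω → C} (hX : Measurable X)
    (hY : Measurable Y) (hW : Measurable W) (h1 : IndepFun X (fun ω => (Y ω, W ω)) P)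
    (h2 : IndepFun Y W P) : IndepFun (fun ω => (X ω, Y ω)) W P := by
  have hXY : IndepFun X Y P := h1.comp measurable_id measurable_fst
  rw [indepFun_iff_map_prod_eq_prod_map_map (by fun_prop) (by fun_prop)] at h1 h2 hXY ⊢
  rw [h2, ← Measure.prodAssoc_prod, ← hXY] at h1
  have h3 := congrArg (Measure.map MeasurableEquiv.prodAssoc.symm) h1
  rw [MeasurableEquiv.map_symm_map, Measure.map_map (MeasurableEquiv.measurable _)
    (by fun_prop)] at h3
  exact h3

lemma indepFun_noise_tail {Z : ℕ → Ω → EuclideanSpace ℝ (Fin n)}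
    (hZ_meas : ∀ t, 1 ≤ t → Measurable (Z t)) (hZ_indep : iIndepFun (fun t : ℕ => Z (t + 1)) P)
    (t : ℕ) : IndepFun (Z (t + 1)) (fun ω (k : ℕ) => Z (t + 1 + k + 1) ω) P := by
  have h := indep_iSup_of_disjoint (fun i => (hZ_meas (i + 1) (by omega)).comap_le)
    hZ_indep.iIndep (S := {t}) (T := Set.Ioi t) (by simp)
  rw [IndepFun_iff_Indep]
  refine indep_of_indep_of_le_left (indep_of_indep_of_le_right h ?_) ?_
  · simp only [MeasurableSpace.pi, MeasurableSpace.comap_iSup, MeasurableSpace.comap_comp]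
    refine iSup_le fun k => ?_
    exact le_iSup₂_of_le (f := fun i (_ : i ∈ Set.Ioi t) =>
      MeasurableSpace.comap (Z (i + 1)) inferInstance) (t + 1 + k)
      (by simp only [Set.mem_Ioi]; omega) le_rfl
  · exact le_iSup₂_of_le (f := fun i (_ : i ∈ ({t} : Set ℕ)) =>
      MeasurableSpace.comap (Z (i + 1)) inferInstance) t rfl le_rfl

lemma exists_measurable_extension {D : Set (EuclideanSpace ℝ (Fin n))} (hD : MeasurableSet D)
    {f : EuclideanSpace ℝ (Fin n) → EuclideanSpace ℝ (Fin n)}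
    (hf : Measurable fun x : D => f x) :
    ∃ g : EuclideanSpace ℝ (Fin n) → EuclideanSpace ℝ (Fin n), Measurable g ∧ Set.EqOn g f D := by
  refine ⟨D.indicator f, ?_, fun x hx => Set.indicator_of_mem hx f⟩
  refine measurable_of_restrict_of_restrict_compl hD ?_ ?_
  · convert hf using 1
    ext1 x
    exact Set.indicator_of_mem x.2 f
  · have : Dᶜ.domRestrict (D.indicator f) = fun _ => 0 :=
      funext fun x => Set.indicator_of_notMem x.2 f
    rw [this]
    exact measurable_const

/-- The iterates have measurable versions that are independent of the later noise. -/
lemma exists_version [IsProbabilityMeasure P] {σ : ℝ} {T : ℕ} {ψ : EuclideanSpace ℝ (Fin n) → EReal}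
    (hψ : IsClosedConvexProper ψ) {f : ℕ → EuclideanSpace ℝ (Fin n) → EuclideanSpace ℝ (Fin n)}
    (hf : ∀ t ∈ Finset.Icc 1 T, Measurable (f t)) {Y Z : ℕ → Ω → EuclideanSpace ℝ (Fin n)}
    (hY0_meas : Measurable (Y 0)) (hZ_meas : ∀ t, 1 ≤ t → Measurable (Z t))
    (hZ_law : ∀ t, 1 ≤ t →
      P.map (Z t) = multivariateGaussian 0 (σ ^ 2 • (1 : Matrix (Fin n) (Fin n) ℝ)))
    (hZ_indep : iIndepFun (fun t : ℕ => Z (t + 1)) P)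
    (hY0_indep : IndepFun (Y 0) (fun ω (t : ℕ) => Z (t + 1) ω) P)
    (hY : ∀ t ∈ Finset.Icc 1 T, ∀ᵐ ω ∂P, Y t ω = prox ψ (f t (Y (t - 1) ω) + Z t ω)) :
    ∀ t ≤ T, (∃ U : Ω → EuclideanSpace ℝ (Fin n), Measurable U ∧ Y t =ᵐ[P] U ∧
      IndepFun U (fun ω (k : ℕ) => Z (t + k + 1) ω) P) ∧
      (t < T → P.map (Y (t + 1)) = lawStep ψ σ (f (t + 1)) (P.map (Y t))) := by
  have hprox := hψ.measurable_prox
  have main : ∀ t < T, ∀ U : Ω → EuclideanSpace ℝ (Fin n), Measurable U → Y t =ᵐ[P] U →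
      Y (t + 1) =ᵐ[P] fun ω => prox ψ (f (t + 1) (U ω) + Z (t + 1) ω) := by
    intro t ht U hU hYU
    filter_upwards [hY (t + 1) (by simp; omega), hYU] with ω h1 h2
    rw [h1, Nat.add_sub_cancel, h2]
  have htail : ∀ t, Measurable fun ω (k : ℕ) => Z (t + k + 1) ω := fun t =>
    measurable_pi_iff.2 fun k => hZ_meas _ (by omega)
  have version : ∀ t ≤ T, ∃ U : Ω → EuclideanSpace ℝ (Fin n), Measurable U ∧ Y t =ᵐ[P] U ∧
      IndepFun U (fun ω (k : ℕ) => Z (t + k + 1) ω) P := by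
    intro t
    induction t with
    | zero => exact fun _ => ⟨Y 0, hY0_meas, Filter.EventuallyEq.rfl, by simpa using hY0_indep⟩
    | succ t ih =>
      intro ht
      obtain ⟨U, hU, hYU, hind⟩ := ih (by omega)
      have hft := hf (t + 1) (by simp; omega)
      have hZt := hZ_meas (t + 1) (by omega)
      have h1 : IndepFun U (fun ω => (Z (t + 1) ω, fun k : ℕ => Z (t + 1 + k + 1) ω)) P := by
        have hm : Measurable fun z : ℕ → EuclideanSpace ℝ (Fin n) =>
          (z 0, fun k : ℕ => z (k + 1)) := by fun_prop
        have := hind.comp measurable_id hm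
        have heq : (fun ω => (Z (t + 1) ω, fun k : ℕ => Z (t + 1 + k + 1) ω)) =
            (fun z : ℕ → EuclideanSpace ℝ (Fin n) => (z 0, fun k : ℕ => z (k + 1))) ∘
              fun ω (k : ℕ) => Z (t + k + 1) ω := by
          funext ω
          refine Prod.ext rfl (funext fun k => ?_)
          change Z (t + 1 + k + 1) ω = Z (t + (k + 1) + 1) ω
          rw [show t + 1 + k + 1 = t + (k + 1) + 1 by omega]
        rw [heq]
        exact this
      have h2 := indepFun_prodMk_left_of_right hU hZt (htail (t + 1)) h1
        (indepFun_noise_tail hZ_meas hZ_indep t)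
      have hm : Measurable fun p : EuclideanSpace ℝ (Fin n) × EuclideanSpace ℝ (Fin n) =>
          prox ψ (f (t + 1) p.1 + p.2) := hprox.comp (by fun_prop)
      exact ⟨_, hprox.comp ((hft.comp hU).add hZt), main t (by omega) U hU hYU,
        h2.comp hm measurable_id⟩
  intro t ht
  refine ⟨version t ht, fun htT => ?_⟩
  obtain ⟨U, hU, hYU, hind⟩ := version t ht
  have hft := hf (t + 1) (by simp; omega)
  have hZt := hZ_meas (t + 1) (by omega)
  have hm : Measurable fun p : EuclideanSpace ℝ (Fin n) × EuclideanSpace ℝ (Fin n) =>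
      prox ψ (f (t + 1) p.1 + p.2) := hprox.comp (by fun_prop)
  have h1 : IndepFun U (Z (t + 1)) P := hind.comp measurable_id (measurable_pi_apply 0)
  rw [indepFun_iff_map_prod_eq_prod_map_map hU.aemeasurable hZt.aemeasurable,
    hZ_law _ (by omega)] at h1
  rw [Measure.map_congr (main t htT U hU hYU), Measure.map_congr hYU, lawStep, ← h1,
    Measure.map_map hm (hU.prodMk hZt)]
  rfl

end Iterates

/-! ### From `wassersteinInf` to couplings, and the final assembly. -/

/-- The strict slack `τ < τ'` avoids having to show that the infimum over couplings is attained. -/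
lemma exists_coupling_of_wassersteinInf_le {n : ℕ} {τ τ' : ℝ} (hτ : 0 ≤ τ) (hττ' : τ < τ')
    {μ γ : Measure (EuclideanSpace ℝ (Fin n))} [IsProbabilityMeasure μ]
    (h : wassersteinInf μ γ ≤ ENNReal.ofReal τ) :
    ∃ π : Measure (EuclideanSpace ℝ (Fin n) × EuclideanSpace ℝ (Fin n)), IsProbabilityMeasure π ∧
      π.map Prod.fst = μ ∧ π.map Prod.snd = γ ∧ ∀ᵐ p ∂π, ‖p.1 - p.2‖ ≤ τ' := by
  have h1 : wassersteinInf μ γ < ENNReal.ofReal τ' :=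
    h.trans_lt ((ENNReal.ofReal_lt_ofReal_iff (hτ.trans_lt hττ')).2 hττ')
  simp only [wassersteinInf, iInf_lt_iff] at h1
  obtain ⟨π, ⟨h2, h3⟩, h4⟩ := h1
  refine ⟨π, ?_, h2, h3, ?_⟩
  · have : IsProbabilityMeasure (π.map Prod.fst) := h2 ▸ inferInstance
    exact Measure.isProbabilityMeasure_of_map Prod.fst
  · filter_upwards [ae_lt_of_essSup_lt h4] with p hp
    rw [← ofReal_norm] at hp
    exact (ENNReal.ofReal_lt_ofReal_iff (hτ.trans_lt hττ')).1 hp |>.le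

end ProxDiv

/-- The maps `φ t`, `φ' t` are total functions whose values off `dom ψ` are irrelevant: the
regularity conditions are required on `dom ψ` only, where all the iterates live. -/
theorem proposition2p2 {n : ℕ} {Ω : Type*} [MeasurableSpace Ω]
    (P : Measure Ω) [IsProbabilityMeasure P]
    (α σ L ζ sbar : ℝ) (hα : 1 < α) (hσ : 0 < σ) (hL : 0 ≤ L) (hζ : 0 ≤ ζ) (hsbar : 0 < sbar)
    (T ℓ : ℕ) (hℓ : 1 ≤ ℓ) (hℓT : ℓ ≤ T)
    (ψ : EuclideanSpace ℝ (Fin n) → EReal) (hψ : ProxDiv.IsClosedConvexProper ψ)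
    (φ φ' : ℕ → EuclideanSpace ℝ (Fin n) → EuclideanSpace ℝ (Fin n))
    (hφ_meas : ∀ t ∈ Finset.Icc 1 T, Measurable (fun x : ProxDiv.effDom ψ => φ t x))
    (hφ'_meas : ∀ t ∈ Finset.Icc 1 T, Measurable (fun x : ProxDiv.effDom ψ => φ' t x))
    (h_close : ∀ t ∈ Finset.Icc 1 T, ∀ u ∈ ProxDiv.effDom ψ,
      ‖φ' t u - φ t u‖ ≤ if t ≡ 1 [MOD ℓ] then sbar else 0)
    (hφ : ∀ t ∈ Finset.Icc 1 T, ∀ x ∈ ProxDiv.effDom ψ, ∀ y ∈ ProxDiv.effDom ψ,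
      ‖φ t x - φ t y‖ ≤ L * ‖x - y‖ + ζ)
    (hφ' : ∀ t ∈ Finset.Icc 1 T, ∀ x ∈ ProxDiv.effDom ψ, ∀ y ∈ ProxDiv.effDom ψ,
      ‖φ' t x - φ' t y‖ ≤ L * ‖x - y‖ + ζ)
    (Y Y' Z : ℕ → Ω → EuclideanSpace ℝ (Fin n))
    (hY0_meas : Measurable (Y 0)) (hY0'_meas : Measurable (Y' 0))
    (hY0 : ∀ᵐ ω ∂P, Y 0 ω ∈ ProxDiv.effDom ψ) (hY0' : ∀ᵐ ω ∂P, Y' 0 ω ∈ ProxDiv.effDom ψ)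
    (hZ_meas : ∀ t, 1 ≤ t → Measurable (Z t))
    (hZ_law : ∀ t, 1 ≤ t →
      P.map (Z t) = multivariateGaussian 0 (σ ^ 2 • (1 : Matrix (Fin n) (Fin n) ℝ)))
    (hZ_indep : iIndepFun (fun t : ℕ => Z (t + 1)) P)
    (hY0_indep : IndepFun (Y 0) (fun ω (t : ℕ) => Z (t + 1) ω) P)
    (hY0'_indep : IndepFun (Y' 0) (fun ω (t : ℕ) => Z (t + 1) ω) P)
    (hY : ∀ t ∈ Finset.Icc 1 T, ∀ᵐ ω ∂P,
      Y t ω = ProxDiv.prox ψ (φ t (Y (t - 1) ω) + Z t ω))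
    (hY' : ∀ t ∈ Finset.Icc 1 T, ∀ᵐ ω ∂P,
      Y' t ω = ProxDiv.prox ψ (φ' t (Y' (t - 1) ω) + Z t ω)) :
    (ζ = 0 → ∀ τ : ℝ, 0 ≤ τ →
      ProxDiv.renyiDiv α (P.map (Y T)) (P.map (Y' T)) ≤
        ProxDiv.shiftedRenyiDiv α τ (P.map (Y 0)) (P.map (Y' 0)) +
          ((α / (2 * σ ^ 2) * ((L * τ + sbar) ^ 2 * ProxDiv.theta L ℓ +
            sbar ^ 2 * ((((T / ℓ : ℕ) : ℝ) - 1) * ProxDiv.theta L ℓ +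
              ProxDiv.theta L (T - (T / ℓ) * ℓ))) : ℝ) : EReal)) ∧
    (ζ = sbar →
      ProxDiv.renyiDiv α (P.map (Y T)) (P.map (Y' T)) ≤
        ProxDiv.renyiDiv α (P.map (Y 0)) (P.map (Y' 0)) +
          ((2 * α * T * (ζ / σ) ^ 2 : ℝ) : EReal)) := by

  have hD := hψ.measurableSet_effDom
  -- The maps are measurable only on `dom ψ`. They are replaced by globally measurable ones, which
  -- changes nothing almost surely because the iterates stay in `dom ψ`.
  choose! f hf hfeq using fun t (ht : t ∈ Finset.Icc 1 T) =>
    ProxDiv.exists_measurable_extension hD (hφ_meas t ht)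
  choose! g hg hgeq using fun t (ht : t ∈ Finset.Icc 1 T) =>
    ProxDiv.exists_measurable_extension hD (hφ'_meas t ht)
  have hYD : ∀ t ≤ T, ∀ᵐ ω ∂P, Y t ω ∈ ProxDiv.effDom ψ := by
    rintro (_ | t) ht
    · exact hY0
    · filter_upwards [hY (t + 1) (by simp; omega)] with ω h using h ▸ hψ.prox_mem _
  have hYD' : ∀ t ≤ T, ∀ᵐ ω ∂P, Y' t ω ∈ ProxDiv.effDom ψ := by
    rintro (_ | t) ht
    · exact hY0'
    · filter_upwards [hY' (t + 1) (by simp; omega)] with ω h using h ▸ hψ.prox_mem _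
  have hYf : ∀ t ∈ Finset.Icc 1 T, ∀ᵐ ω ∂P,
      Y t ω = ProxDiv.prox ψ (f t (Y (t - 1) ω) + Z t ω) := by
    intro t ht
    filter_upwards [hY t ht, hYD (t - 1) (by simp at ht; omega)] with ω h1 h2
    rw [h1, hfeq t ht h2]
  have hYg : ∀ t ∈ Finset.Icc 1 T, ∀ᵐ ω ∂P,
      Y' t ω = ProxDiv.prox ψ (g t (Y' (t - 1) ω) + Z t ω) := by
    intro t ht
    filter_upwards [hY' t ht, hYD' (t - 1) (by simp at ht; omega)] with ω h1 h2
    rw [h1, hgeq t ht h2]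
  have hV := ProxDiv.exists_version hψ hf hY0_meas hZ_meas hZ_law hZ_indep hY0_indep hYf
  have hV' := ProxDiv.exists_version hψ hg hY0'_meas hZ_meas hZ_law hZ_indep hY0'_indep hYg
  have hYm : ∀ t ≤ T, AEMeasurable (Y t) P := fun t ht =>
    let ⟨⟨U, hU, hYU, _⟩, _⟩ := hV t ht; ⟨U, hU, hYU⟩
  have hYm' : ∀ t ≤ T, AEMeasurable (Y' t) P := fun t ht =>
    let ⟨⟨U, hU, hYU, _⟩, _⟩ := hV' t ht; ⟨U, hU, hYU⟩
  obtain ⟨β, hαβ⟩ : ∃ β, α.HolderConjugate β := ⟨_, Real.HolderConjugate.conjExponent hα⟩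
  have hα1 : 0 < α - 1 := sub_pos.2 hα
  have hstep : ∀ t < T, ∀ τ c a b, 0 ≤ a → a ≤ b →
      (∀ x ∈ ProxDiv.effDom ψ, ∀ y ∈ ProxDiv.effDom ψ, ‖x - y‖ ≤ τ →
        ‖φ (t + 1) x - φ' (t + 1) y‖ ≤ b) →
      ProxDiv.ShiftedDualBound β c τ (P.map (Y t)) (P.map (Y' t)) →
      ProxDiv.ShiftedDualBound β (c + (α - 1) / (2 * σ ^ 2) * a ^ 2) (b - a)
        (P.map (Y (t + 1))) (P.map (Y' (t + 1))) := by
    intro t ht τ c a b ha hab hxy h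
    have htI : t + 1 ∈ Finset.Icc 1 T := by simp; omega
    rw [(hV t ht.le).2 ht, (hV' t ht.le).2 ht]
    refine h.step hσ hαβ hψ (hf _ htI) (hg _ htI)
      ((ae_map_iff (hYm t ht.le) hD).2 (hYD t ht.le))
      ((ae_map_iff (hYm' t ht.le) hD).2 (hYD' t ht.le)) (fun x hx y hy hd => ?_) ha hab
    rw [hfeq _ htI hx, hgeq _ htI hy]
    exact hxy x hx y hy hd
  have hp : ∀ t ≤ T, IsProbabilityMeasure (P.map (Y t)) := fun t ht =>
    Measure.isProbabilityMeasure_map (hYm t ht)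
  have hp' : ∀ t ≤ T, IsProbabilityMeasure (P.map (Y' t)) := fun t ht =>
    Measure.isProbabilityMeasure_map (hYm' t ht)
  have := hp 0 (Nat.zero_le T)
  have := hp' 0 (Nat.zero_le T)
  have := hp T le_rfl
  have := hp' T le_rfl
  have hlast : ∀ c, ProxDiv.ShiftedDualBound β c 0 (P.map (Y T)) (P.map (Y' T)) →
      ProxDiv.renyiDiv α (P.map (Y T)) (P.map (Y' T)) ≤ ((α / (α - 1) * c : ℝ) : EReal) :=
    fun c h => h.dualBound.renyiDiv_le hαβ
  constructor
  · rintro rfl τ hτ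
    set B : ℝ → ℝ := fun τ => (L * τ + sbar) ^ 2 * ProxDiv.theta L ℓ +
      sbar ^ 2 * ((((T / ℓ : ℕ) : ℝ) - 1) * ProxDiv.theta L ℓ +
        ProxDiv.theta L (T - (T / ℓ) * ℓ)) with hB
    change _ ≤ _ + ((α / (2 * σ ^ 2) * B τ : ℝ) : EReal)
    have hmono : ∀ γ : Measure (EuclideanSpace ℝ (Fin n)), IsProbabilityMeasure γ →
        ProxDiv.wassersteinInf (P.map (Y 0)) γ ≤ ENNReal.ofReal τ →
        ProxDiv.renyiDiv α (P.map (Y T)) (P.map (Y' T)) ≤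
          ProxDiv.renyiDiv α γ (P.map (Y' 0)) + ((α / (2 * σ ^ 2) * B τ : ℝ) : EReal) := by
      intro γ hγ hW
      by_cases htop : ProxDiv.renyiDiv α γ (P.map (Y' 0)) = ⊤
      · rw [htop, EReal.top_add_coe]
        exact le_top
      obtain ⟨c, hc, hdual⟩ := ProxDiv.exists_dualBound_of_renyiDiv_ne_top hαβ htop
      have key : ∀ τ' > τ, ProxDiv.renyiDiv α (P.map (Y T)) (P.map (Y' T)) ≤
          ((α / (α - 1) * c + α / (2 * σ ^ 2) * B τ' : ℝ) : EReal) := by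
        intro τ' hτ'
        have hτ'0 : 0 ≤ τ' := hτ.trans hτ'.le
        obtain ⟨π, hπ, hπ1, hπ2, hd⟩ :=
          ProxDiv.exists_coupling_of_wassersteinInf_le hτ hτ' hW
        have h0 : ProxDiv.ShiftedDualBound β c τ' (P.map (Y 0)) (P.map (Y' 0)) :=
          ⟨π, hπ, hπ1, hd, hπ2 ▸ hdual⟩
        have h1 := ProxDiv.epoch_cost (C := fun t τ c =>
          ProxDiv.ShiftedDualBound β c τ (P.map (Y t)) (P.map (Y' t)))
          (κ := (α - 1) / (2 * σ ^ 2)) hL hsbar.le hτ'0 hℓ hℓT ?_ h0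
        · refine (hlast _ h1).trans_eq ?_
          congr 1
          change α / (α - 1) * (c + (α - 1) / (2 * σ ^ 2) * B τ') = _
          field_simp
        · intro t ht τ c a hτ ha hab h
          refine hstep t ht τ c a _ ha hab (fun x hx y hy hxy => ?_) h
          have htI : t + 1 ∈ Finset.Icc 1 T := by simp; omega
          have h2 := hφ (t + 1) htI x hx y hy
          have h3 := h_close (t + 1) htI y hy
          have h4 : t + 1 ≡ 1 [MOD ℓ] ↔ ℓ ∣ t := by
            rw [Nat.ModEq.comm, Nat.modEq_iff_dvd' (by omega), Nat.add_sub_cancel]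
          simp only [h4] at h3
          have h5 := norm_sub_le_norm_sub_add_norm_sub (φ (t + 1) x) (φ (t + 1) y)
            (φ' (t + 1) y)
          rw [norm_sub_rev (φ (t + 1) y)] at h5
          have h6 : L * ‖x - y‖ ≤ L * τ := by gcongr
          linarith
      rw [hc, ← EReal.coe_add]
      -- The bound is continuous in the initial displacement, so `τ'` may decrease to `τ`.
      have hlim : Filter.Tendsto (fun τ' =>
          ((α / (α - 1) * c + α / (2 * σ ^ 2) * B τ' : ℝ) : EReal)) (nhdsWithin τ (Set.Ioi τ))
          (nhds ((α / (α - 1) * c + α / (2 * σ ^ 2) * B τ : ℝ) : EReal)) :=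
        ((continuous_coe_real_ereal.comp (by fun_prop)).tendsto τ).mono_left nhdsWithin_le_nhds
      refine ge_of_tendsto hlim ?_
      filter_upwards [self_mem_nhdsWithin] with τ' hτ' using key τ' hτ'
    -- The finite constant is moved to the left so that the infimum over `γ` stands alone.
    rw [← EReal.sub_le_iff_le_add (.inl (EReal.coe_ne_bot _)) (.inl (EReal.coe_ne_top _))]
    exact le_iInf fun γ => le_iInf fun hγ => le_iInf fun hW =>
      EReal.sub_le_of_le_add (hmono γ hγ hW)
  · rintro rfl
    by_cases htop : ProxDiv.renyiDiv α (P.map (Y 0)) (P.map (Y' 0)) = ⊤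
    · rw [htop, EReal.top_add_coe]
      exact le_top
    obtain ⟨c, hc, hdual⟩ := ProxDiv.exists_dualBound_of_renyiDiv_ne_top hαβ htop
    have hrun : ∀ t ≤ T, ProxDiv.ShiftedDualBound β
        (c + (α - 1) / (2 * σ ^ 2) * (t * ζ ^ 2)) 0 (P.map (Y t)) (P.map (Y' t)) := by
      intro t
      induction t with
      | zero =>
        intro _
        have hm : Measurable fun x : EuclideanSpace ℝ (Fin n) => (x, x) := by fun_prop
        refine ⟨(P.map (Y 0)).map fun x => (x, x),
          Measure.isProbabilityMeasure_map hm.aemeasurable, ?_, ?_, ?_⟩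
        · rw [Measure.map_map measurable_fst hm]
          exact Measure.map_id
        · rw [ae_map_iff hm.aemeasurable (measurableSet_le (by fun_prop) measurable_const)]
          simp
        · rw [Measure.map_map measurable_snd hm]
          have h1 : (P.map (Y 0)).map (Prod.snd ∘ fun x => (x, x)) = P.map (Y 0) :=
            Measure.map_id
          rw [h1]
          simpa using hdual
      | succ t ih =>
        intro ht
        -- With `a = b = ζ` the displacement returns to zero. At displacement zero `x = y`, so only
        -- `h_close` is needed.
        have h1 := hstep t ht 0 _ ζ ζ hζ le_rfl (fun x hx y hy hxy => ?_) (ih (by omega))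
        · rw [sub_self] at h1
          convert h1 using 1
          push_cast
          ring
        · have hxy' := sub_eq_zero.1 (norm_le_zero_iff.1 hxy)
          rw [hxy', norm_sub_rev]
          refine (h_close (t + 1) (by simp; omega) y hy).trans ?_
          split_ifs
          · exact le_rfl
          · exact hζ
    refine (hlast _ (hrun T le_rfl)).trans ?_
    rw [hc, ← EReal.coe_add, EReal.coe_le_coe_iff]
    -- The actual cost is `α T ζ² / (2σ²)`, a quarter of what is claimed; the subtracted term is the
    -- surplus.
    have h1 : α / (α - 1) * (c + (α - 1) / (2 * σ ^ 2) * (T * ζ ^ 2)) =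
        α / (α - 1) * c + 2 * α * T * (ζ / σ) ^ 2 - 3 / 2 * (α * T * (ζ / σ) ^ 2) := by
      field_simp
      ring
    rw [h1]
    have : 0 ≤ α * T * (ζ / σ) ^ 2 := by positivity
    linarith
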